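/- Let $X=(X_1,X_2,X_3)\sim\mathcal N(\mu,\Sigma)$ with $\mu\in\mathbb R^3$ and $\Sigma$ a positive definite $3\times 3$ matrix. Let $f$ be the Gaussian density of $X$, let $f_{12}=f_{(X_1,X_2)}$ and $f_3$ be the marginal densities of $(X_1,X_2)$ and $X_3$, and for $x_3\in\mathbb R$ let $f(x_1,x_2|x_3)=f(x_1,x_2,x_3)/f_3(x_3)$ be the conditional density, also written $f_{(X_1,X_2)|x_3}$. Write $\Sigma_1=(\Sigma_{ij})_{i,j\le 2}$ and, for $i,j\in\{1,2\}$, $$\bar\mu_i=\mu_i+\Sigma_{i3}\Sigma_{33}^{-1}(x_3-\mu_3),\qquad \bar\Sigma_{ij}=\Sigma_{ij}-\Sigma_{i3}\Sigma_{33}^{-1}\Sigma_{3j},\qquad d_i=\bar\mu_i-\mu_i=\Sigma_{i3}\Sigma_{33}^{-1}(x_3-\mu_3).$$ For non-negative functions $g,h$ and a weight function $\varphi\ge 0$ on $\mathbb R^2$ put $H(g)=-\int g\log g$, $H^{\rm w}_\varphi(g)=-\int\varphi\, g\log g$, $D(g\|h)=\int g\log\frac gh$ and $D^{\rm w}_\varphi(g\|h)=\int\varphi\,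 g\log\frac gh$. Let $$\phi(x_1,x_2)=\prod_{k=1}^2(x_k-\mu_k)^2,\qquad \phi_{(X_1,X_2)|x_3}=\frac{f_{(X_1,X_2)|x_3}}{f_{12}},\qquad \phi'_{(X_1,X_2)|x_3}=\phi\,\frac{f_{(X_1,X_2)|x_3}}{f_{12}},$$ and, expectations being taken with respect to the density $f(\cdot,\cdot|x_3)$, $$\Theta(x_3)=E\Big[\prod_{k=1}^2(X_k-\mu_k)^2\Big|X_3=x_3\Big],\qquad \bar\Lambda_{ij}=E\Big[\prod_{k=1}^2(X_k-\mu_k)^2(X_i-\bar\mu_i)(X_j-\bar\mu_j)\Big|X_3=x_3\Big],$$ $$\Upsilon_{ij}=E\Big[\prod_{k=1}^2(X_k-\mu_k)^2(X_i-\mu_i)(X_j-\mu_j)\Big|X_3=x_3\Big].$$ Then $f$ is a density of the law of $X$, the matrices $\Sigma_1$ and $\bar\Sigma$ are positive definite, $f_{12}$ is the $\mathcal N((\mu_1,\mu_2),\Sigma_1)$ density, and the conditional law of $(X_1,X_2)$ given $X_3=x_3$ is $\mathcal N(\bar\mu,\bar\Sigma)$ for almost every $x_3$ with respect to the law of $X_3$.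 Moreover, for every $x_3\in\mathbb R$, $f_{(X_1,X_2)|x_3}$ is the $\mathcal N(\bar\mu,\bar\Sigma)$ density, all integrals in question converge absolutely, and the following hold. 1. (KL divergence) $$D(f_{(X_1,X_2)|x_3}\|f_{12})=H^{\rm w}_{\phi_{(X_1,X_2)|x_3}}(f_{12})-H(f_{(X_1,X_2)|x_3}),\qquad H(f_{(X_1,X_2)|x_3})=\tfrac12\log\big((2\pi e)^2|\bar\Sigma|\big),$$ $$H^{\rm w}_{\phi_{(X_1,X_2)|x_3}}(f_{12})=\tfrac12\log\big((2\pi)^2|\Sigma_1|\big)+\tfrac12\sum_{i,j=1}^2(\Sigma_1^{-1})_{ij}\{\bar\Sigma_{ij}+\bar\mu_i\bar\mu_j-\mu_j\bar\mu_i-\mu_i\bar\mu_j+\mu_i\mu_j\},$$ and therefore $$D(f_{(X_1,X_2)|x_3}\|f_{12})=\tfrac12\log\big((2\pi)^2|\Sigma_1|\big)-\tfrac12\log\big((2\pi)^2|\bar\Sigma|\big)+\tfrac12\sum_{i,j=1}^2(\Sigma_1^{-1})_{ij}\{\bar\Sigma_{ij}+\bar\mu_i\bar\mu_j-\mu_j\bar\mu_i-\mu_i\bar\mu_j+\mu_i\mu_j\}-1.$$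 2. (conditional weighted entropy) $$H^{\rm w}_\phi(f_{(X_1,X_2)|x_3})=\tfrac12\log\big((2\pi)^2|\bar\Sigma|\big)\,\Theta(x_3)+\tfrac12\sum_{i,j=1}^2(\bar\Sigma^{-1})_{ij}\bar\Lambda_{ij}.$$ 3. (weighted entropy with weight $\phi'$) $$H^{\rm w}_{\phi'_{(X_1,X_2)|x_3}}(f_{12})=\tfrac12\log\big((2\pi)^2|\Sigma_1|\big)\,\Theta(x_3)+\tfrac12\sum_{i,j=1}^2(\Sigma_1^{-1})_{ij}\Upsilon_{ij}.$$ 4. (weighted KL divergence) $$D^{\rm w}_\phi(f_{(X_1,X_2)|x_3}\|f_{12})=H^{\rm w}_{\phi'_{(X_1,X_2)|x_3}}(f_{12})-H^{\rm w}_\phi(f_{(X_1,X_2)|x_3})=\tfrac12\log\frac{|\Sigma_1|}{|\bar\Sigma|}\,\Theta(x_3)+\tfrac12\sum_{i,j=1}^2(\Sigma_1^{-1})_{ij}\Upsilon_{ij}-\tfrac12\sum_{i,j=1}^2(\bar\Sigma^{-1})_{ij}\bar\Lambda_{ij}.$$ 5. (explicit values) For indices in $\{1,2\}$ put $M_{abcd}=\bar\Sigma_{ab}\bar\Sigma_{cd}+\bar\Sigma_{ac}\bar\Sigma_{bd}+\bar\Sigma_{ad}\bar\Sigma_{bc}$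 and $$M_{1122ij}=\bar\Sigma_{11}(\bar\Sigma_{22}\bar\Sigma_{ij}+2\bar\Sigma_{2i}\bar\Sigma_{2j})+2\bar\Sigma_{12}(\bar\Sigma_{12}\bar\Sigma_{ij}+\bar\Sigma_{1i}\bar\Sigma_{2j}+\bar\Sigma_{1j}\bar\Sigma_{2i})+\bar\Sigma_{1i}(2\bar\Sigma_{12}\bar\Sigma_{2j}+\bar\Sigma_{22}\bar\Sigma_{1j})+\bar\Sigma_{1j}(2\bar\Sigma_{12}\bar\Sigma_{2i}+\bar\Sigma_{22}\bar\Sigma_{1i}).$$ Then $$\Theta(x_3)=\bar\Sigma_{11}\bar\Sigma_{22}+2\bar\Sigma_{12}^2+\bar\Sigma_{11}d_2^2+\bar\Sigma_{22}d_1^2+4\bar\Sigma_{12}d_1d_2+d_1^2d_2^2,$$ $$\bar\Lambda_{ij}=M_{1122ij}+d_2^2M_{11ij}+d_1^2M_{22ij}+d_1^2d_2^2\bar\Sigma_{ij}+4d_1d_2M_{12ij},$$ $$\begin{aligned}\Upsilon_{ij}={}&M_{1122ij}+M_{1122}d_id_j+2M_{112i}d_2d_j+2M_{112j}d_2d_i+M_{11ij}d_2^2+\bar\Sigma_{11}d_2^2d_id_j\\&+2M_{122i}d_1d_j+2M_{122j}d_1d_i+4M_{12ij}d_1d_2+4\bar\Sigma_{12}d_1d_2d_id_j+2\bar\Sigma_{1i}d_jd_1d_2^2+2\bar\Sigma_{1j}d_id_1d_2^2\\&+M_{22ij}d_1^2+\bar\Sigma_{22}d_1^2d_id_j+2\bar\Sigma_{2i}d_2d_1^2d_j+2\bar\Sigma_{2j}d_2d_1^2d_i+\bar\Sigma_{ij}d_1^2d_2^2+d_1^2d_2^2d_id_j.\end{aligned}$$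 -/

import Mathlib

open MeasureTheory ProbabilityTheory

namespace WeightedGaussian

noncomputable section

/-! ### Entropies and divergences of functions on `ℝⁿ` -/

/-- Differential entropy `H(f) = -∫ f log f`. -/
def diffEntropy {n : ℕ} (f : EuclideanSpace ℝ (Fin n) → ℝ) : ℝ :=
  -∫ x, f x * Real.log (f x)

/-- Weighted differential entropy `H^w_φ(f) = -∫ φ f log f`. -/
def weightedEntropy {n : ℕ} (φ f : EuclideanSpace ℝ (Fin n) → ℝ) : ℝ :=
  -∫ x, φ x * f x * Real.log (f x)

/-- Relative entropy (Kullback-Leibler divergence) `D(f ‖ g) = ∫ f log (f / g)`. -/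
def relEntropy {n : ℕ} (f g : EuclideanSpace ℝ (Fin n) → ℝ) : ℝ :=
  ∫ x, f x * Real.log (f x / g x)

/-- Relative weighted entropy (weighted Kullback-Leibler divergence)
`D^w_φ(f ‖ g) = ∫ φ f log (f / g)`. -/
def relWeightedEntropy {n : ℕ} (φ f g : EuclideanSpace ℝ (Fin n) → ℝ) : ℝ :=
  ∫ x, φ x * f x * Real.log (f x / g x)

/-! ### Densities. The three components have indices `0, 1, 2`. -/

/-- The nondegenerate Gaussian density with mean `μ` and covariance matrix `S`. -/
def gaussianDensity {n : ℕ} (μ : EuclideanSpace ℝ (Fin n)) (S : Matrix (Fin n) (Fin n) ℝ)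
    (x : EuclideanSpace ℝ (Fin n)) : ℝ :=
  (Real.sqrt ((2 * Real.pi) ^ n * S.det))⁻¹ *
    Real.exp (-(1 / 2) * ∑ i, ∑ j, (x i - μ i) * S⁻¹ i j * (x j - μ j))

/-- The pair formed by the first two components of a vector. -/
def firstTwo (x : EuclideanSpace ℝ (Fin 3)) : EuclideanSpace ℝ (Fin 2) := !₂[x 0, x 1]

/-- The third component of a vector. -/
def third (x : EuclideanSpace ℝ (Fin 3)) : ℝ := x 2

/-- The marginal density of the first two components, for a joint density `f`. -/
def marginalPair (f : EuclideanSpace ℝ (Fin 3) → ℝ) (x : EuclideanSpace ℝ (Fin 2)) : ℝ :=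
  ∫ t : ℝ, f !₂[x 0, x 1, t]

/-- The marginal density of the third component, for a joint density `f`. -/
def marginalThird (f : EuclideanSpace ℝ (Fin 3) → ℝ) (t : ℝ) : ℝ :=
  ∫ x : EuclideanSpace ℝ (Fin 2), f !₂[x 0, x 1, t]

/-- The conditional density `f(x₁, x₂ | x₃) = f(x₁, x₂, x₃) / f₃(x₃)`. -/
def condDensity (f : EuclideanSpace ℝ (Fin 3) → ℝ) (x₃ : ℝ) (x : EuclideanSpace ℝ (Fin 2)) : ℝ :=
  f !₂[x 0, x 1, x₃] / marginalThird f x₃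

/-- The conditional expectation `E[g(X₁, X₂) | X₃ = x₃]`, for a joint density `f`. -/
def condMean (f : EuclideanSpace ℝ (Fin 3) → ℝ) (x₃ : ℝ)
    (g : EuclideanSpace ℝ (Fin 2) → ℝ) : ℝ :=
  ∫ x, g x * condDensity f x₃ x

/-! ### Parameters of the marginal and of the conditional law -/

/-- Covariance matrix `Σ₁` of the first two components. -/
def covPair (S : Matrix (Fin 3) (Fin 3) ℝ) : Matrix (Fin 2) (Fin 2) ℝ :=
  !![S 0 0, S 0 1; S 1 0, S 1 1]

/-- Conditional mean vector: `μ̄ᵢ = μᵢ + Σᵢ₃ Σ₃₃⁻¹ (x₃ - μ₃)`. -/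
def muBar (μ : EuclideanSpace ℝ (Fin 3)) (S : Matrix (Fin 3) (Fin 3) ℝ) (x₃ : ℝ) :
    EuclideanSpace ℝ (Fin 2) :=
  !₂[μ 0 + S 0 2 * (S 2 2)⁻¹ * (x₃ - μ 2), μ 1 + S 1 2 * (S 2 2)⁻¹ * (x₃ - μ 2)]

/-- Conditional covariance matrix: `Σ̄ᵢⱼ = Σᵢⱼ - Σᵢ₃ Σ₃₃⁻¹ Σ₃ⱼ`. -/
def sigmaBar (S : Matrix (Fin 3) (Fin 3) ℝ) : Matrix (Fin 2) (Fin 2) ℝ :=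
  !![S 0 0 - S 0 2 * (S 2 2)⁻¹ * S 2 0, S 0 1 - S 0 2 * (S 2 2)⁻¹ * S 2 1;
     S 1 0 - S 1 2 * (S 2 2)⁻¹ * S 2 0, S 1 1 - S 1 2 * (S 2 2)⁻¹ * S 2 1]

/-! ### Weight functions and conditional moments.
Here `m` is the (unconditional) mean of the pair, `mb` its conditional mean. -/

/-- The central moments weight function `φ(x₁, x₂) = (x₁ - m₁)² (x₂ - m₂)²`. -/
def centralWeight (m x : EuclideanSpace ℝ (Fin 2)) : ℝ := ∏ k, (x k - m k) ^ 2

/-- The likelihood-ratio weight `f(x₁, x₂ | x₃) / f(x₁, x₂)`. -/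
def ratioWeight (f : EuclideanSpace ℝ (Fin 3) → ℝ) (x₃ : ℝ) (x : EuclideanSpace ℝ (Fin 2)) : ℝ :=
  condDensity f x₃ x / marginalPair f x

/-- The weight `φ'(x₁, x₂) = (x₁ - m₁)² (x₂ - m₂)² f(x₁, x₂ | x₃) / f(x₁, x₂)`. -/
def centralRatioWeight (f : EuclideanSpace ℝ (Fin 3) → ℝ) (m : EuclideanSpace ℝ (Fin 2)) (x₃ : ℝ)
    (x : EuclideanSpace ℝ (Fin 2)) : ℝ :=
  centralWeight m x * ratioWeight f x₃ x

/-- `Θ(x₃) = E[∏ₖ (Xₖ - mₖ)² | X₃ = x₃]`. -/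
def Theta (f : EuclideanSpace ℝ (Fin 3) → ℝ) (m : EuclideanSpace ℝ (Fin 2)) (x₃ : ℝ) : ℝ :=
  condMean f x₃ fun x => ∏ k, (x k - m k) ^ 2

/-- `Λ̄ᵢⱼ = E[∏ₖ (Xₖ - mₖ)² (Xᵢ - mbᵢ) (Xⱼ - mbⱼ) | X₃ = x₃]`. -/
def LambdaBar (f : EuclideanSpace ℝ (Fin 3) → ℝ) (m mb : EuclideanSpace ℝ (Fin 2)) (x₃ : ℝ)
    (i j : Fin 2) : ℝ :=
  condMean f x₃ fun x => (∏ k, (x k - m k) ^ 2) * (x i - mb i) * (x j - mb j)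

/-- `Υᵢⱼ = E[∏ₖ (Xₖ - mₖ)² (Xᵢ - mᵢ) (Xⱼ - mⱼ) | X₃ = x₃]`. -/
def Upsilon (f : EuclideanSpace ℝ (Fin 3) → ℝ) (m : EuclideanSpace ℝ (Fin 2)) (x₃ : ℝ)
    (i j : Fin 2) : ℝ :=
  condMean f x₃ fun x => (∏ k, (x k - m k) ^ 2) * (x i - m i) * (x j - m j)

/-! ### The explicit expressions.
`C` is a `2 × 2` covariance matrix, `Y ~ N(0, C)`, and `d` is the difference of the means. -/

/-- The value of `E[Yₐ Y_b Y_c Y_d]`, the sum over the three pairings of `a, b, c, d`. -/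
def moment4 (C : Matrix (Fin 2) (Fin 2) ℝ) (a b c d : Fin 2) : ℝ :=
  C a b * C c d + C a c * C b d + C a d * C b c

/-- The value of `E[Y₁² Y₂² Yᵢ Yⱼ]`. -/
def moment6 (C : Matrix (Fin 2) (Fin 2) ℝ) (i j : Fin 2) : ℝ :=
  C 0 0 * (C 1 1 * C i j + 2 * C 1 i * C 1 j)
    + 2 * C 0 1 * (C 0 1 * C i j + C 0 i * C 1 j + C 0 j * C 1 i)
    + C 0 i * (2 * C 0 1 * C 1 j + C 1 1 * C 0 j)
    + C 0 j * (2 * C 0 1 * C 1 i + C 1 1 * C 0 i)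

/-- Explicit expression of `Θ(x₃)`. -/
def thetaExpr (C : Matrix (Fin 2) (Fin 2) ℝ) (d : Fin 2 → ℝ) : ℝ :=
  (C 0 0 * C 1 1 + 2 * C 0 1 ^ 2) + C 0 0 * d 1 ^ 2 + C 1 1 * d 0 ^ 2
    + 4 * C 0 1 * (d 0 * d 1) + d 0 ^ 2 * d 1 ^ 2

/-- Explicit expression of `Λ̄ᵢⱼ`. -/
def lambdaExpr (C : Matrix (Fin 2) (Fin 2) ℝ) (d : Fin 2 → ℝ) (i j : Fin 2) : ℝ :=
  moment6 C i j + d 1 ^ 2 * moment4 C 0 0 i j + d 0 ^ 2 * moment4 C 1 1 i j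
    + d 0 ^ 2 * d 1 ^ 2 * C i j + 4 * (d 0 * d 1) * moment4 C 0 1 i j

/-- Explicit expression of `Υᵢⱼ`. -/
def upsilonExpr (C : Matrix (Fin 2) (Fin 2) ℝ) (d : Fin 2 → ℝ) (i j : Fin 2) : ℝ :=
  moment6 C i j + moment4 C 0 0 1 1 * d i * d j
    + 2 * moment4 C 0 0 1 i * d 1 * d j + 2 * moment4 C 0 0 1 j * d 1 * d i
    + moment4 C 0 0 i j * d 1 ^ 2 + C 0 0 * d 1 ^ 2 * d i * d j
    + 2 * moment4 C 0 1 1 i * d 0 * d j + 2 * moment4 C 0 1 1 j * d 0 * d i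
    + 4 * moment4 C 0 1 i j * d 0 * d 1 + 4 * C 0 1 * (d 0 * d 1) * d i * d j
    + 2 * C 0 i * d j * d 0 * d 1 ^ 2 + 2 * C 0 j * d i * d 0 * d 1 ^ 2
    + moment4 C 1 1 i j * d 0 ^ 2 + C 1 1 * d 0 ^ 2 * d i * d j
    + 2 * C 1 i * d 1 * d 0 ^ 2 * d j + 2 * C 1 j * d 1 * d 0 ^ 2 * d i
    + C i j * (d 0 ^ 2 * d 1 ^ 2) + (d 0 ^ 2 * d 1 ^ 2) * d i * d j

/-- The difference of conditional and unconditional means, `dₖ = Σₖ₃ Σ₃₃⁻¹ (x₃ - μ₃)`. -/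
def meanShift (μ : EuclideanSpace ℝ (Fin 3)) (S : Matrix (Fin 3) (Fin 3) ℝ) (x₃ : ℝ) :
    Fin 2 → ℝ :=
  ![S 0 2 * (S 2 2)⁻¹ * (x₃ - μ 2), S 1 2 * (S 2 2)⁻¹ * (x₃ - μ 2)]

end

end WeightedGaussian

/-! Every entropy in the theorem is an integral of a polynomial against a Gaussian density. By the
Schur complement, the joint density factors as the `N(muBar, sigmaBar)` density in `x₁, x₂` times
the density of `X₃` (`gaussianDensity_eq_cond_mul`). This identifies the conditional density and, by
uniqueness of disintegrations, the conditional law. The opposite factorization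
(`gaussianDensity_eq_mul_cond`) gives the marginal of the pair.

The logarithm of a Gaussian density is a quadratic polynomial, and so is its expression in `x - mb`
(`eval_logPoly`). The weights `φr` and `φ'` contain the ratio of the conditional to the marginal
density, so multiplying by `f₁₂` turns them back into `1` and `φ` times the conditional density.
Hence each quantity equals a central moment of `N(mb, Sb)`, and the entropy formulas follow from one
identity, `integral_eval_mul_gaussianDensity_mul_log`. Absolute convergence holds because Gaussian
measures integrate all polynomials.

The explicit values need moments up to order six. These come from Stein's identity
`gaussMoment_X_mul`, that is `E[Yᵢ p(Y)] = ∑ᵦ Sᵢᵦ E[∂ᵦ p(Y)]`. It is deduced from one-dimensional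
integration by parts through the substitution `Y = √S Z`. -/

namespace WeightedGaussian

open Matrix
open scoped MatrixOrder ENNReal NNReal

/-! ### Densities under pushforward and product. -/

/-- Pushing a density forward along a map that multiplies the reference measure by a constant. -/
lemma map_withDensity_of_map_eq_smul {α β : Type*} [MeasurableSpace α] [MeasurableSpace β]
    {ν : Measure α} {ρ : Measure β} {T : α → β} (hT : Measurable T) {c : ℝ≥0∞}
    (hc : ν.map T = c • ρ) {g : α → ℝ≥0∞} {h : β → ℝ≥0∞} (hh : Measurable h)
    (hg : ∀ x, c * g x = h (T x)) (hc0 : c ≠ 0) (hctop : c ≠ ∞) :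
    (ν.withDensity g).map T = ρ.withDensity h := by
  -- Since `c` is invertible, `g` factors through `T`, so measurability of `h` is enough.
  have hg' : g = fun x => c⁻¹ * h (T x) := by
    funext x
    rw [← hg, ← mul_assoc, ENNReal.inv_mul_cancel hc0 hctop, one_mul]
  ext s hs
  rw [Measure.map_apply hT hs, withDensity_apply _ (hT hs), withDensity_apply _ hs, hg',
    lintegral_const_mul c⁻¹ (f := fun x => h (T x)) (hh.comp hT), ← setLIntegral_map hs hh hT, hc,
    Measure.restrict_smul,
    lintegral_smul_measure, smul_eq_mul, ← mul_assoc, ENNReal.inv_mul_cancel hc0 hctop, one_mul]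

/-- A product of measures on `ℝ` with integrable densities has the product density. -/
lemma pi_withDensity_ofReal {ι : Type*} [Fintype ι] {f : ι → ℝ → ℝ}
    (hf : ∀ i, Integrable (f i)) (hf0 : ∀ i x, 0 ≤ f i x) :
    Measure.pi (fun i => volume.withDensity fun x => ENNReal.ofReal (f i x)) =
      (volume : Measure (ι → ℝ)).withDensity fun x => ENNReal.ofReal (∏ i, f i (x i)) := by
  have hfin (i : ι) : IsFiniteMeasure (volume.withDensity fun x => ENNReal.ofReal (f i x)) :=
    isFiniteMeasure_withDensity_ofReal (hf i).2
  refine Measure.pi_eq fun s hs => ?_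
  have hind : (Set.univ.pi s).indicator (fun x : ι → ℝ => ∏ i, f i (x i)) =
      fun x => ∏ i, (s i).indicator (f i) (x i) := by
    classical
    funext x
    by_cases hx : x ∈ Set.univ.pi s
    · rw [Set.indicator_of_mem hx]
      exact Finset.prod_congr rfl fun i _ => (Set.indicator_of_mem (hx i trivial) _).symm
    · rw [Set.indicator_of_notMem hx]
      obtain ⟨i, hi⟩ : ∃ i, x i ∉ s i := by simpa [Set.mem_pi] using hx
      exact (Finset.prod_eq_zero (Finset.mem_univ i) (Set.indicator_of_notMem hi _)).symm
  have hbox : MeasurableSet (Set.univ.pi s) := MeasurableSet.univ_pi hs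
  have hI : Integrable (fun x : ι → ℝ => ∏ i, f i (x i)) (volume : Measure (ι → ℝ)) :=
    Integrable.fintype_prod hf
  rw [withDensity_apply _ hbox, ← ofReal_integral_eq_lintegral_ofReal
    (hI.restrict (s := Set.univ.pi s))
    (Filter.Eventually.of_forall fun x => Finset.prod_nonneg fun i _ => hf0 i _),
    ← integral_indicator hbox, hind,
    integral_fintype_prod_volume_eq_prod (fun i => (s i).indicator (f i)),
    ENNReal.ofReal_prod_of_nonneg fun i _ => integral_nonneg fun x =>
      Set.indicator_nonneg (fun x _ => hf0 i x) x]
  refine Finset.prod_congr rfl fun i _ => ?_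
  rw [withDensity_apply _ (hs i), integral_indicator (hs i),
    ofReal_integral_eq_lintegral_ofReal (hf i).restrict
      (Filter.Eventually.of_forall fun x => hf0 i x)]

/-! ### The Lebesgue density of a nondegenerate Gaussian law. -/

section Density

variable {n : ℕ} {μ : EuclideanSpace ℝ (Fin n)} {S : Matrix (Fin n) (Fin n) ℝ}

lemma continuous_gaussianDensity : Continuous (gaussianDensity μ S) := by
  unfold gaussianDensity; fun_prop

lemma gaussianDensity_pos (hS : S.PosDef) (x : EuclideanSpace ℝ (Fin n)) :
    0 < gaussianDensity μ S x := by
  have := hS.det_pos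
  unfold gaussianDensity; positivity

lemma sum_sum_eq_dotProduct (M : Matrix (Fin n) (Fin n) ℝ) (v : Fin n → ℝ) :
    ∑ i, ∑ j, v i * M i j * v j = v ⬝ᵥ M *ᵥ v := by
  simp only [dotProduct, mulVec, Finset.mul_sum, mul_assoc]

lemma log_gaussianDensity (hS : S.PosDef) (x : EuclideanSpace ℝ (Fin n)) :
    Real.log (gaussianDensity μ S x) = -(1 / 2) * Real.log ((2 * Real.pi) ^ n * S.det) -
      1 / 2 * ∑ i, ∑ j, S⁻¹ i j * ((x i - μ i) * (x j - μ j)) := by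
  have := hS.det_pos
  unfold gaussianDensity
  rw [Real.log_mul (by positivity) (Real.exp_ne_zero _), Real.log_inv, Real.log_exp,
    Real.log_sqrt (by positivity)]
  have : ∑ i, ∑ j, (x i - μ i) * S⁻¹ i j * (x j - μ j) =
      ∑ i, ∑ j, S⁻¹ i j * ((x i - μ i) * (x j - μ j)) :=
    Finset.sum_congr rfl fun i _ => Finset.sum_congr rfl fun j _ => by ring
  rw [this]
  ring

lemma stdGaussian_eq_withDensity :
    stdGaussian (EuclideanSpace ℝ (Fin n)) =
      volume.withDensity fun x => ENNReal.ofReal (gaussianDensity 0 1 x) := by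
  rw [← map_pi_eq_stdGaussian]
  have h1 : gaussianReal 0 1 = volume.withDensity fun x => ENNReal.ofReal (gaussianPDFReal 0 1 x) :=
    gaussianReal_of_var_ne_zero 0 one_ne_zero
  rw [h1, pi_withDensity_ofReal (fun _ => integrable_gaussianPDFReal 0 1)
    fun _ => gaussianPDFReal_nonneg 0 1]
  refine map_withDensity_of_map_eq_smul (c := 1) (by fun_prop) ?_ ?_ ?_ one_ne_zero
    ENNReal.one_ne_top
  · rw [one_smul, (PiLp.volume_preserving_toLp (Fin n)).map_eq]
  · exact continuous_gaussianDensity.measurable.ennreal_ofReal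
  · intro x
    rw [one_mul]
    congr 1
    have h2 : Real.sqrt ((2 * Real.pi) ^ n) = Real.sqrt (2 * Real.pi) ^ n := by
      rw [Real.sqrt_eq_iff_mul_self_eq (by positivity) (by positivity), ← mul_pow,
        Real.mul_self_sqrt (by positivity)]
    simp only [gaussianPDFReal, gaussianDensity, Finset.prod_mul_distrib, Finset.prod_const,
      ← Real.exp_sum]
    have h3 : ∑ i, -(x i - 0) ^ 2 / (2 * ((1 : ℝ≥0) : ℝ)) = -(1 / 2) * ∑ i, x i * x i := by
      rw [Finset.mul_sum]
      exact Finset.sum_congr rfl fun i _ => by simp; ring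
    rw [h3]
    simp only [NNReal.coe_one, mul_one, det_one, h2, PiLp.zero_apply, sub_zero, inv_one,
      sum_sum_eq_dotProduct, one_mulVec, Finset.card_univ, Fintype.card_fin, inv_pow]
    rfl

/-- The multivariate Gaussian law with positive definite covariance has the Gaussian density. -/
lemma multivariateGaussian_eq_withDensity (hS : S.PosDef) :
    multivariateGaussian μ S =
      volume.withDensity fun x => ENNReal.ofReal (gaussianDensity μ S x) := by
  set A := CFC.sqrt S with hA
  have hAA : A * A = S := CFC.sqrt_mul_sqrt_self _ hS.posSemidef.nonneg
  have hAt : Aᵀ = A := by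
    have : A.IsHermitian := (CFC.sqrt_nonneg S).isSelfAdjoint
    simpa [Matrix.IsHermitian, conjTranspose_eq_transpose_of_trivial] using this
  have hdet : A.det * A.det = S.det := by rw [← det_mul, hAA]
  have hSd := hS.det_pos
  have hA0 : A.det ≠ 0 := fun h => by simp [h] at hdet; linarith
  have hAu : IsUnit A.det := isUnit_iff_ne_zero.2 hA0
  have hsq : Real.sqrt S.det = |A.det| := by rw [← hdet, Real.sqrt_mul_self_eq_abs]
  have hld : LinearMap.det (toEuclideanCLM (𝕜 := ℝ) A : EuclideanSpace ℝ (Fin n) →ₗ[ℝ] _) = A.det := by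
    rw [coe_toEuclideanCLM_eq_toEuclideanLin, toEuclideanLin_eq_toLin_orthonormal,
      LinearMap.det_toLin]
  rw [multivariateGaussian, stdGaussian_eq_withDensity]
  -- The affine map `x ↦ μ + A x` multiplies Lebesgue measure by `|det A|⁻¹`.
  refine map_withDensity_of_map_eq_smul (c := ENNReal.ofReal |A.det⁻¹|) (by fun_prop) ?_ ?_ ?_
    (by simpa using hA0) ENNReal.ofReal_ne_top
  · have : (fun x : EuclideanSpace ℝ (Fin n) => μ + toEuclideanCLM (𝕜 := ℝ) A x) =
      (fun x => μ + x) ∘ (toEuclideanCLM (𝕜 := ℝ) A : EuclideanSpace ℝ (Fin n) →ₗ[ℝ] _) := rfl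
    rw [this, ← Measure.map_map (measurable_const_add μ)
      (show Measurable (toEuclideanCLM (𝕜 := ℝ) A : EuclideanSpace ℝ (Fin n) →ₗ[ℝ] _) from
        (toEuclideanCLM (𝕜 := ℝ) A).continuous.measurable),
      Measure.map_linearMap_addHaar_eq_smul_addHaar _ (by rw [hld]; exact hA0), hld,
      Measure.map_smul, map_add_left_eq_self]
  · exact continuous_gaussianDensity.measurable.ennreal_ofReal
  · intro x
    rw [← ENNReal.ofReal_mul (abs_nonneg _)]
    congr 1
    unfold gaussianDensity
    have hq : ∑ i, ∑ j, (((μ + toEuclideanCLM (𝕜 := ℝ) A x : EuclideanSpace ℝ (Fin n)) i - μ i) * S⁻¹ i j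
        * ((μ + toEuclideanCLM (𝕜 := ℝ) A x : EuclideanSpace ℝ (Fin n)) j - μ j)) =
        ∑ i, ∑ j, (x i - (0 : EuclideanSpace ℝ (Fin n)) i) * (1 : Matrix (Fin n) (Fin n) ℝ)⁻¹ i j *
          (x j - (0 : EuclideanSpace ℝ (Fin n)) j) := by
      simp only [PiLp.add_apply, add_sub_cancel_left, ofLp_toEuclideanCLM, PiLp.zero_apply,
        sub_zero, inv_one]
      -- With `S⁻¹ = A⁻¹ A⁻¹` and `A` symmetric, both factors `A` cancel: `(A x) · S⁻¹ (A x) = x ·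
      -- x`.
      rw [sum_sum_eq_dotProduct, sum_sum_eq_dotProduct, one_mulVec, ← hAA, Matrix.mul_inv_rev,
        mulVec_mulVec, mul_assoc, nonsing_inv_mul _ hAu, mul_one]
      conv_lhs => rw [← vecMul_transpose, hAt]
      rw [← dotProduct_mulVec, mulVec_mulVec, mul_nonsing_inv _ hAu, one_mulVec]
    rw [hq, Real.sqrt_mul (by positivity) S.det, hsq, abs_inv, det_one, mul_one, mul_inv]
    ring

lemma integral_multivariateGaussian (hS : S.PosDef) (g : EuclideanSpace ℝ (Fin n) → ℝ) :
    ∫ x, g x ∂multivariateGaussian μ S = ∫ x, g x * gaussianDensity μ S x := by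
  rw [multivariateGaussian_eq_withDensity hS, integral_withDensity_eq_integral_toReal_smul
    continuous_gaussianDensity.measurable.ennreal_ofReal (by simp)]
  refine integral_congr_ae (Filter.Eventually.of_forall fun x => ?_)
  simp [ENNReal.toReal_ofReal (gaussianDensity_pos hS x).le, mul_comm]

lemma integrable_multivariateGaussian_iff (hS : S.PosDef) (g : EuclideanSpace ℝ (Fin n) → ℝ) :
    Integrable g (multivariateGaussian μ S) ↔ Integrable fun x => g x * gaussianDensity μ S x := by
  rw [multivariateGaussian_eq_withDensity hS, integrable_withDensity_iff
    continuous_gaussianDensity.measurable.ennreal_ofReal (by simp)]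
  simp [ENNReal.toReal_ofReal (gaussianDensity_pos hS _).le]

lemma integral_gaussianDensity (hS : S.PosDef) : ∫ x, gaussianDensity μ S x = 1 := by
  simpa using (integral_multivariateGaussian (μ := μ) hS fun _ => 1).symm

end Density

/-! ### Stein's identity for the standard Gaussian. -/

/-- Gaussian integration by parts for monomials. -/
lemma integral_pow_succ_gaussianReal (k : ℕ) :
    ∫ x, x ^ (k + 1) ∂gaussianReal 0 1 = k * ∫ x, x ^ (k - 1) ∂gaussianReal 0 1 := by
  have hint (m : ℕ) : Integrable fun x : ℝ => x ^ m * Real.exp (-x ^ 2 / 2) := by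
    have := integrable_rpow_mul_exp_neg_mul_sq (b := 1 / 2) (by norm_num) (s := m)
      (by have : (0 : ℝ) ≤ m := m.cast_nonneg
          linarith)
    refine this.congr (Filter.Eventually.of_forall fun x => ?_)
    beta_reduce
    rw [Real.rpow_natCast]
    congr 2; ring
  have hd (x : ℝ) : HasDerivAt (fun x : ℝ => -Real.exp (-x ^ 2 / 2))
      (x * Real.exp (-x ^ 2 / 2)) x := by
    refine (((hasDerivAt_pow 2 x).neg.div_const 2).exp).neg.congr_deriv ?_
    simp only [Nat.cast_ofNat, Pi.neg_apply]
    ring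
  -- The factor `x * exp (-x ^ 2 / 2)` is the derivative of `-exp (-x ^ 2 / 2)`. For `k = 0` the
  -- truncated exponent `k - 1` is harmless because of the coefficient `k`.
  have hibp := integral_mul_deriv_eq_deriv_mul_of_integrable
    (u := fun x : ℝ => x ^ k) (u' := fun x => k * x ^ (k - 1))
    (v := fun x => -Real.exp (-x ^ 2 / 2)) (v' := fun x => x * Real.exp (-x ^ 2 / 2))
    (fun x _ => hasDerivAt_pow k x) (fun x _ => hd x) ?_ ?_ ?_
  · have hred (m : ℕ) : ∫ x, x ^ m ∂gaussianReal 0 1 =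
        (Real.sqrt (2 * Real.pi))⁻¹ * ∫ x, x ^ m * Real.exp (-x ^ 2 / 2) := by
      rw [integral_gaussianReal_eq_integral_smul one_ne_zero, ← integral_const_mul]
      refine integral_congr_ae (Filter.Eventually.of_forall fun x => ?_)
      simp [gaussianPDFReal]; ring
    rw [hred, hred, mul_left_comm, ← integral_const_mul (k : ℝ)]
    simp only [mul_neg, integral_neg, neg_neg] at hibp
    simp only [pow_succ, mul_assoc] at hibp ⊢
    rw [hibp]
  · exact (hint (k + 1)).congr (Filter.Eventually.of_forall fun x => by simp [pow_succ, mul_assoc])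
  · exact ((hint (k - 1)).const_mul (-k)).congr
      (Filter.Eventually.of_forall fun x => by simp [mul_assoc])
  · exact (hint k).neg.congr (Filter.Eventually.of_forall fun x => by simp)

variable {n : ℕ}

lemma integrable_monomial_pi_gaussianReal (d : Fin n → ℕ) :
    Integrable (fun x : Fin n → ℝ => ∏ i, x i ^ d i)
      (Measure.pi fun _ => gaussianReal 0 1) := by
  refine Integrable.fintype_prod (f := fun i (x : ℝ) => x ^ d i) fun i => ?_
  have := (memLp_id_gaussianReal (μ := 0) (v := 1) (d i : NNReal)).integrable_norm_pow'
  refine (integrable_norm_iff (by fun_prop)).1 (by simpa using this)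

lemma integrable_eval_pi_gaussianReal (p : MvPolynomial (Fin n) ℝ) :
    Integrable (fun x : Fin n → ℝ => MvPolynomial.eval x p)
      (Measure.pi fun _ => gaussianReal 0 1) := by
  simp only [MvPolynomial.eval_eq']
  exact integrable_finsetSum _ fun d _ => (integrable_monomial_pi_gaussianReal d).const_mul _

/-- The integral of polynomials against the standard Gaussian measure, as a linear map. -/
noncomputable def stdMoment : MvPolynomial (Fin n) ℝ →ₗ[ℝ] ℝ where
  toFun p := ∫ x : Fin n → ℝ, MvPolynomial.eval x p ∂Measure.pi fun _ => gaussianReal 0 1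
  map_add' p q := by
    simp only [map_add]
    exact integral_add (integrable_eval_pi_gaussianReal p) (integrable_eval_pi_gaussianReal q)
  map_smul' c p := by
    simp only [MvPolynomial.smul_eval, RingHom.id_apply, smul_eq_mul]
    exact integral_const_mul _ _

lemma stdMoment_monomial (d : Fin n →₀ ℕ) (c : ℝ) :
    stdMoment (MvPolynomial.monomial d c) = c * ∏ i, ∫ x, x ^ d i ∂gaussianReal 0 1 := by
  simp only [stdMoment, LinearMap.coe_mk, AddHom.coe_mk, MvPolynomial.eval_monomial]
  rw [integral_const_mul]
  simp only [Finsupp.prod_pow]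
  rw [integral_fintype_prod_eq_prod (fun i (x : ℝ) => x ^ d i)]

/-- Stein's identity for the standard Gaussian measure. -/
lemma stdMoment_X_mul (k : Fin n) (p : MvPolynomial (Fin n) ℝ) :
    stdMoment (MvPolynomial.X k * p) = stdMoment (MvPolynomial.pderiv k p) := by
  induction p using MvPolynomial.induction_on' with
  | add p q hp hq => simp only [mul_add, map_add, hp, hq]
  | monomial d c =>
    rw [MvPolynomial.pderiv_monomial, MvPolynomial.X, MvPolynomial.monomial_mul,
      stdMoment_monomial, stdMoment_monomial, one_mul, mul_assoc]
    congr 1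
    rw [← Finset.mul_prod_erase _ _ (Finset.mem_univ k),
      ← Finset.mul_prod_erase _ _ (Finset.mem_univ k), ← mul_assoc]
    congr 1
    · simpa [add_comm] using integral_pow_succ_gaussianReal (d k)
    · refine Finset.prod_congr rfl fun i hi => ?_
      have : k ≠ i := (Finset.ne_of_mem_erase hi).symm
      simp [this]

/-! ### Stein's identity and Isserlis' formulas for general covariance. -/

section CentralMoments

variable {n : ℕ} {μ : EuclideanSpace ℝ (Fin n)} {S : Matrix (Fin n) (Fin n) ℝ}

/-- The substitution `Yᵢ = ∑ₖ (√S)ᵢₖ Zₖ` on polynomials. -/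
noncomputable def sqrtSubst (S : Matrix (Fin n) (Fin n) ℝ) :
    MvPolynomial (Fin n) ℝ →ₐ[ℝ] MvPolynomial (Fin n) ℝ :=
  MvPolynomial.aeval fun i => ∑ k, CFC.sqrt S i k • MvPolynomial.X k

/-- The central moments of `N(μ, S)`, as a linear map on polynomials. -/
noncomputable def gaussMoment (S : Matrix (Fin n) (Fin n) ℝ) : MvPolynomial (Fin n) ℝ →ₗ[ℝ] ℝ :=
  stdMoment ∘ₗ (sqrtSubst S).toLinearMap

lemma multivariateGaussian_eq_map_pi :
    multivariateGaussian μ S = (Measure.pi fun _ => gaussianReal 0 1).map fun z : Fin n → ℝ =>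
      μ + toEuclideanCLM (𝕜 := ℝ) (CFC.sqrt S) (WithLp.toLp 2 z) := by
  rw [multivariateGaussian, ← map_pi_eq_stdGaussian, Measure.map_map (by fun_prop) (by fun_prop)]
  rfl

lemma eval_sqrtSubst (p : MvPolynomial (Fin n) ℝ) (z : Fin n → ℝ) :
    MvPolynomial.eval (fun i => (μ + toEuclideanCLM (𝕜 := ℝ) (CFC.sqrt S) (WithLp.toLp 2 z) :
      EuclideanSpace ℝ (Fin n)) i - μ i) p = MvPolynomial.eval z (sqrtSubst S p) := by
  induction p using MvPolynomial.induction_on with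
  | C a => simp [sqrtSubst]
  | add p q hp hq => simp only [map_add, hp, hq]
  | mul_X p i hp =>
    rw [map_mul, hp, map_mul, map_mul, MvPolynomial.eval_X]
    simp [sqrtSubst, mulVec, dotProduct]

lemma continuous_eval_sub (p : MvPolynomial (Fin n) ℝ) : Continuous
    fun x : EuclideanSpace ℝ (Fin n) => MvPolynomial.eval (fun i => x i - μ i) p :=
  (MvPolynomial.continuous_eval p).comp (by fun_prop)

lemma integrable_eval_multivariateGaussian (p : MvPolynomial (Fin n) ℝ) :
    Integrable (fun x : EuclideanSpace ℝ (Fin n) => MvPolynomial.eval (fun i => x i - μ i) p)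
      (multivariateGaussian μ S) := by
  rw [multivariateGaussian_eq_map_pi, integrable_map_measure
    (continuous_eval_sub p).aestronglyMeasurable (by fun_prop)]
  refine (integrable_eval_pi_gaussianReal (sqrtSubst S p)).congr
    (Filter.Eventually.of_forall fun z => ?_)
  exact (eval_sqrtSubst p z).symm

lemma integral_eval_multivariateGaussian (p : MvPolynomial (Fin n) ℝ) :
    ∫ x : EuclideanSpace ℝ (Fin n), MvPolynomial.eval (fun i => x i - μ i) p
      ∂multivariateGaussian μ S = gaussMoment S p := by
  rw [multivariateGaussian_eq_map_pi, integral_map (by fun_prop)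
    (continuous_eval_sub p).aestronglyMeasurable]
  simp only [eval_sqrtSubst]
  rfl

/-- This is the chain rule for `Y = √S Z`: differentiating in `Z` produces a second factor `√S`, and
`√S √S = S`. Both sides obey the same Leibniz rule, so it suffices to compare them on variables. -/
lemma sum_sqrt_smul_pderiv_sqrtSubst (hS : S.PosSemidef) (i : Fin n)
    (p : MvPolynomial (Fin n) ℝ) :
    ∑ k, CFC.sqrt S i k • MvPolynomial.pderiv k (sqrtSubst S p) =
      sqrtSubst S (MvPolynomial.mkDerivation ℝ (fun b => MvPolynomial.C (S i b)) p) := by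
  have hAA : CFC.sqrt S * CFC.sqrt S = S := CFC.sqrt_mul_sqrt_self _ hS.nonneg
  have hAt : (CFC.sqrt S).IsHermitian := (CFC.sqrt_nonneg S).isSelfAdjoint
  induction p using MvPolynomial.induction_on with
  | C a => simp [sqrtSubst]
  | add p q hp hq => simp only [map_add, smul_add, Finset.sum_add_distrib, hp, hq]
  | mul_X p j hp =>
    have hX : ∑ k, CFC.sqrt S i k • MvPolynomial.pderiv k (sqrtSubst S (MvPolynomial.X j)) =
        MvPolynomial.C (S i j) := by
      have h1 (k : Fin n) : MvPolynomial.pderiv k (sqrtSubst S (MvPolynomial.X j)) =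
          MvPolynomial.C (CFC.sqrt S j k) := by
        simp [sqrtSubst, MvPolynomial.pderiv_X, Pi.single_apply, MvPolynomial.smul_eq_C_mul]
      have h2 (k : Fin n) : CFC.sqrt S j k = CFC.sqrt S k j := by
        simpa using hAt.apply k j
      simp only [h1, h2, MvPolynomial.smul_eq_C_mul, ← map_mul, ← map_sum]
      rw [← Matrix.mul_apply, hAA]
    simp only [map_mul, Derivation.leibniz, smul_add, Finset.sum_add_distrib, smul_eq_mul,
      MvPolynomial.mkDerivation_X, map_add, ← hp]
    congr 1
    · simp only [← mul_smul_comm, ← Finset.mul_sum, hX]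
      simp [sqrtSubst]
    · simp only [← mul_smul_comm, ← Finset.mul_sum]

/-- Stein's identity for central moments of `N(μ, S)`. -/
lemma gaussMoment_X_mul (hS : S.PosSemidef) (i : Fin n) (p : MvPolynomial (Fin n) ℝ) :
    gaussMoment S (MvPolynomial.X i * p) =
      gaussMoment S (MvPolynomial.mkDerivation ℝ (fun b => MvPolynomial.C (S i b)) p) := by
  simp only [gaussMoment, LinearMap.comp_apply, AlgHom.toLinearMap_apply, map_mul,
    ← sum_sqrt_smul_pderiv_sqrtSubst hS, map_sum, map_smul, ← stdMoment_X_mul]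
  simp only [sqrtSubst, MvPolynomial.aeval_X, Finset.sum_mul, map_sum, smul_mul_assoc, map_smul]

lemma gaussMoment_one : gaussMoment S 1 = 1 := by
  simp [← integral_eval_multivariateGaussian (μ := 0) (S := S)]

lemma gaussMoment_C_mul (c : ℝ) (p : MvPolynomial (Fin n) ℝ) :
    gaussMoment S (p * MvPolynomial.C c) = c * gaussMoment S p := by
  rw [mul_comm, ← MvPolynomial.smul_eq_C_mul, map_smul, smul_eq_mul]

open MvPolynomial

lemma gaussMoment_C (c : ℝ) : gaussMoment S (C c) = c := by
  simpa [gaussMoment_one] using gaussMoment_C_mul (S := S) c 1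

lemma gaussMoment_X (hS : S.PosSemidef) (a : Fin n) : gaussMoment S (X a) = 0 := by
  simpa using gaussMoment_X_mul hS a 1

lemma gaussMoment_X2 (hS : S.PosSemidef) (a b : Fin n) : gaussMoment S (X a * X b) = S a b := by
  simp [gaussMoment_X_mul hS, gaussMoment_C]

lemma gaussMoment_X3 (hS : S.PosSemidef) (a b c : Fin n) :
    gaussMoment S (X a * (X b * X c)) = 0 := by
  simp [gaussMoment_X_mul hS a, gaussMoment_C_mul, gaussMoment_X hS]

/-- Isserlis' formula for four factors. -/
lemma gaussMoment_X4 (hS : S.PosSemidef) (a b c d : Fin n) :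
    gaussMoment S (X a * (X b * (X c * X d))) = S a b * S c d + S a c * S b d + S a d * S b c := by
  -- One use of Stein's identity pairs `a` with each other index and lowers the degree by two.
  rw [gaussMoment_X_mul hS a]
  simp [mul_add, ← mul_assoc, gaussMoment_C_mul, gaussMoment_X2 hS]
  have hs (k l : Fin n) : S k l = S l k := by simpa using hS.isHermitian.apply l k
  rw [hs d b, hs d c]
  ring

lemma gaussMoment_X5 (hS : S.PosSemidef) (a b c d e : Fin n) :
    gaussMoment S (X a * (X b * (X c * (X d * X e)))) = 0 := by
  rw [gaussMoment_X_mul hS a]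
  simp [mul_add, ← mul_assoc, gaussMoment_C_mul]
  simp [mul_assoc, gaussMoment_X3 hS]

/-- Isserlis' formula for six factors. -/
lemma gaussMoment_X6 (hS : S.PosSemidef) (a b c d e f : Fin n) :
    gaussMoment S (X a * (X b * (X c * (X d * (X e * X f))))) =
      S a b * (S c d * S e f + S c e * S d f + S c f * S d e)
      + S a c * (S b d * S e f + S b e * S d f + S b f * S d e)
      + S a d * (S b c * S e f + S b e * S c f + S b f * S c e)
      + S a e * (S b c * S d f + S b d * S c f + S b f * S c d)
      + S a f * (S b c * S d e + S b d * S c e + S b e * S c d) := by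
  rw [gaussMoment_X_mul hS a]
  simp [mul_add, ← mul_assoc, gaussMoment_C_mul]
  simp [mul_assoc, gaussMoment_X4 hS]
  have hs (k l : Fin n) : S k l = S l k := by simpa using hS.isHermitian.apply l k
  rw [hs f b, hs f c, hs f d, hs f e, hs e b, hs e c, hs e d, hs d b, hs d c]
  ring

end CentralMoments

/-! ### Moments of the weight polynomial in two variables. -/

section Pair

open MvPolynomial

variable {S : Matrix (Fin 2) (Fin 2) ℝ}

/-- The polynomial `(Y₁ + u)² (Y₂ + v)²`. -/
noncomputable def weightPoly (u v : ℝ) : MvPolynomial (Fin 2) ℝ := (X 0 + C u) ^ 2 * (X 1 + C v) ^ 2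

/-- Keeping `q` arbitrary and nesting the products to the right puts every term in the form to which
the moment formulas apply. -/
lemma gaussMoment_weightPoly_mul (u v : ℝ) (q : MvPolynomial (Fin 2) ℝ) :
    gaussMoment S (weightPoly u v * q) =
      gaussMoment S (X 0 * (X 0 * (X 1 * (X 1 * q))))
      + 2 * v * gaussMoment S (X 0 * (X 0 * (X 1 * q))) + v ^ 2 * gaussMoment S (X 0 * (X 0 * q))
      + 2 * u * gaussMoment S (X 0 * (X 1 * (X 1 * q)))
      + 4 * u * v * gaussMoment S (X 0 * (X 1 * q)) + 2 * u * v ^ 2 * gaussMoment S (X 0 * q)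
      + u ^ 2 * gaussMoment S (X 1 * (X 1 * q)) + 2 * u ^ 2 * v * gaussMoment S (X 1 * q)
      + u ^ 2 * v ^ 2 * gaussMoment S q := by
  -- By linearity both sides become `gaussMoment S` of a single polynomial, leaving a polynomial
  -- identity.
  simp only [← smul_eq_mul (α := ℝ), ← map_smul, ← map_add]
  simp only [weightPoly, smul_eq_C_mul, smul_eq_mul, map_mul, map_pow, map_ofNat]
  congr 1
  ring

lemma gaussMoment_mul_X_add_C (p : MvPolynomial (Fin 2) ℝ) (i : Fin 2) (s : ℝ) :
    gaussMoment S (p * (X i + C s)) = gaussMoment S (p * X i) + s * gaussMoment S p := by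
  rw [mul_add, map_add, gaussMoment_C_mul]

lemma gaussMoment_weightPoly (hS : S.PosSemidef) (u v : ℝ) :
    gaussMoment S (weightPoly u v) = thetaExpr S ![u, v] := by
  rw [← mul_one (weightPoly u v), gaussMoment_weightPoly_mul]
  simp only [mul_one, gaussMoment_one, gaussMoment_X hS, gaussMoment_X2 hS,
    gaussMoment_X3 hS, gaussMoment_X4 hS, thetaExpr, cons_val_zero, cons_val_one]
  ring

/-- The free shifts `s, t` serve both matrices: zero shifts give `Λ`, and the shifts `d i`, `d j`
give `Υ`. -/
lemma gaussMoment_weightPoly_mul_mul (hS : S.PosSemidef) (u v s t : ℝ) (i j : Fin 2) :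
    gaussMoment S (weightPoly u v * (X i + C s) * (X j + C t)) =
      moment6 S i j + moment4 S 0 0 1 1 * s * t
      + 2 * moment4 S 0 0 1 i * v * t + 2 * moment4 S 0 0 1 j * v * s
      + moment4 S 0 0 i j * v ^ 2 + S 0 0 * v ^ 2 * s * t
      + 2 * moment4 S 0 1 1 i * u * t + 2 * moment4 S 0 1 1 j * u * s
      + 4 * moment4 S 0 1 i j * u * v + 4 * S 0 1 * (u * v) * s * t
      + 2 * S 0 i * t * u * v ^ 2 + 2 * S 0 j * s * u * v ^ 2
      + moment4 S 1 1 i j * u ^ 2 + S 1 1 * u ^ 2 * s * t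
      + 2 * S 1 i * v * u ^ 2 * t + 2 * S 1 j * v * u ^ 2 * s
      + S i j * (u ^ 2 * v ^ 2) + (u ^ 2 * v ^ 2) * s * t := by
  rw [gaussMoment_mul_X_add_C, mul_right_comm, gaussMoment_mul_X_add_C, gaussMoment_mul_X_add_C,
    mul_assoc, mul_comm (X j) (X i), gaussMoment_weightPoly_mul, gaussMoment_weightPoly_mul,
    gaussMoment_weightPoly_mul, gaussMoment_weightPoly hS]
  simp only [gaussMoment_X hS, gaussMoment_X2 hS, gaussMoment_X3 hS, gaussMoment_X4 hS,
    gaussMoment_X5 hS, gaussMoment_X6 hS, moment4, moment6, thetaExpr, cons_val_zero, cons_val_one]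
  ring

end Pair

/-! ### The Schur complement and the conditional factorization. -/

section Conditioning

variable {μ : EuclideanSpace ℝ (Fin 3)} {S : Matrix (Fin 3) (Fin 3) ℝ}

lemma posDef_covPair (hS : S.PosDef) : (covPair S).PosDef := by
  have h : covPair S = S.submatrix ![0, 1] ![0, 1] := by
    ext i j; fin_cases i <;> fin_cases j <;> rfl
  rw [h]
  exact hS.submatrix (by intro i j; fin_cases i <;> fin_cases j <;> simp)

lemma posDef_fin_two {a b c : ℝ} (ha : 0 < a) (h : 0 < a * c - b * b) :
    (!![a, b; b, c] : Matrix (Fin 2) (Fin 2) ℝ).PosDef := by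
  refine PosDef.of_dotProduct_mulVec_pos ?_ fun x hx => ?_
  · ext i j; fin_cases i <;> fin_cases j <;> rfl
  · simp only [dotProduct, mulVec, Fin.sum_univ_two, star_trivial, of_apply, cons_val_zero,
      cons_val_one]
    have hne : x 0 ≠ 0 ∨ x 1 ≠ 0 := by
      by_contra! h0
      exact hx (by ext i; fin_cases i; exacts [h0.1, h0.2])
    -- Completing the square, after multiplying by `a` to avoid division.
    have key : a * (x 0 * (a * x 0 + b * x 1) + x 1 * (b * x 0 + c * x 1)) =
        (a * x 0 + b * x 1) ^ 2 + (a * c - b * b) * x 1 ^ 2 := by ring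
    refine pos_of_mul_pos_right (a := a) ?_ ha.le
    rw [key]
    rcases eq_or_ne (x 1) 0 with h1 | h1
    · have h0 : x 0 ≠ 0 := by simpa [h1] using hne
      simp only [h1]
      simp only [mul_zero, add_zero]
      positivity
    · positivity

lemma symm_of_posDef (hS : S.PosDef) (i j : Fin 3) : S j i = S i j := by
  simpa using hS.isHermitian.apply i j

lemma det_eq_det_sigmaBar_mul (hS : S.PosDef) : S.det = (sigmaBar S).det * S 2 2 := by
  have h := (hS.diag_pos (i := 2)).ne'
  rw [det_fin_three, sigmaBar, det_fin_two_of]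
  field_simp
  ring

lemma posDef_sigmaBar (hS : S.PosDef) : (sigmaBar S).PosDef := by
  have h2 := hS.diag_pos (i := 2)
  have hd := hS.det_pos
  rw [det_eq_det_sigmaBar_mul hS] at hd
  have hd' := pos_of_mul_pos_left hd h2.le
  have h01 : S 1 0 = S 0 1 := symm_of_posDef hS 0 1
  have h02 : S 2 0 = S 0 2 := symm_of_posDef hS 0 2
  have h12 : S 2 1 = S 1 2 := symm_of_posDef hS 1 2
  have h3 : S 1 0 - S 1 2 * (S 2 2)⁻¹ * S 2 0 = S 0 1 - S 0 2 * (S 2 2)⁻¹ * S 2 1 := by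
    rw [h01, h02, h12]; ring
  rw [sigmaBar, det_fin_two_of] at hd'
  rw [sigmaBar]
  rw [h3] at hd' ⊢
  refine posDef_fin_two ?_ hd'
  -- The upper left entry of the Schur complement is this principal minor divided by `S 2 2`.
  have hsub : (S.submatrix ![0, 2] ![0, 2]).PosDef :=
    hS.submatrix (by intro i j; fin_cases i <;> fin_cases j <;> simp)
  have hpos := hsub.det_pos
  simp only [det_fin_two, submatrix_apply, cons_val_zero, cons_val_one] at hpos
  have : S 0 0 - S 0 2 * (S 2 2)⁻¹ * S 2 0 = (S 0 0 * S 2 2 - S 0 2 * S 2 0) / S 2 2 := by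
    field_simp
  rw [this]
  positivity

lemma gaussianDensity_eq_cond_mul (hS : S.PosDef) (x : EuclideanSpace ℝ (Fin 2)) (t : ℝ) :
    gaussianDensity μ S !₂[x 0, x 1, t] = gaussianDensity (muBar μ S t) (sigmaBar S) x *
      gaussianPDFReal (μ 2) (S 2 2).toNNReal t := by
  have h2 := hS.diag_pos (i := 2)
  have hdb := (posDef_sigmaBar hS).det_pos
  have hdet := det_eq_det_sigmaBar_mul hS
  unfold gaussianDensity gaussianPDFReal
  rw [mul_mul_mul_comm, ← Real.exp_add, ← mul_inv, ← Real.sqrt_mul (by positivity),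
    Real.coe_toNNReal _ h2.le, hdet]
  have hpi : (2 * Real.pi) ^ 3 * ((sigmaBar S).det * S 2 2) =
      (2 * Real.pi) ^ 2 * (sigmaBar S).det * (2 * Real.pi * S 2 2) := by ring
  rw [hpi]
  congr 2
  rw [Matrix.inv_def, Matrix.inv_def, hdet]
  have hD : (sigmaBar S).det = (S 0 0 - S 0 2 * (S 2 2)⁻¹ * S 2 0) *
    (S 1 1 - S 1 2 * (S 2 2)⁻¹ * S 2 1) - (S 0 1 - S 0 2 * (S 2 2)⁻¹ * S 2 1) *
    (S 1 0 - S 1 2 * (S 2 2)⁻¹ * S 2 0) := by rw [sigmaBar, det_fin_two_of]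
  have h01 : S 1 0 = S 0 1 := symm_of_posDef hS 0 1
  have h02 : S 2 0 = S 0 2 := symm_of_posDef hS 0 2
  have h12 : S 2 1 = S 1 2 := symm_of_posDef hS 1 2
  rw [h01, h02, h12] at hD
  set D := (sigmaBar S).det
  simp only [adjugate_fin_three, adjugate_fin_two, sigmaBar, muBar, Fin.sum_univ_three,
    Fin.sum_univ_two, Matrix.smul_apply, smul_eq_mul, Ring.inverse_eq_inv', of_apply, cons_val_zero,
    cons_val_one, cons_val, h01, h02, h12]
  have hD0 : D ≠ 0 := hdb.ne'
  have h20 := h2.ne'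
  -- The entries of `S` are rewritten through those of the Schur complement, which then become
  -- independent atoms `a, b, c`; the exponents reduce to a rational identity with `D = a * c - b *
  -- b`.
  have e00 : S 0 0 = (S 0 0 - S 0 2 * (S 2 2)⁻¹ * S 0 2) + S 0 2 * (S 2 2)⁻¹ * S 0 2 := by ring
  have e01 : S 0 1 = (S 0 1 - S 0 2 * (S 2 2)⁻¹ * S 1 2) + S 0 2 * (S 2 2)⁻¹ * S 1 2 := by ring
  have e11 : S 1 1 = (S 1 1 - S 1 2 * (S 2 2)⁻¹ * S 1 2) + S 1 2 * (S 2 2)⁻¹ * S 1 2 := by ring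
  have hba : S 0 1 - S 1 2 * (S 2 2)⁻¹ * S 0 2 = S 0 1 - S 0 2 * (S 2 2)⁻¹ * S 1 2 := by ring
  rw [hba] at hD ⊢
  generalize S 0 0 - S 0 2 * (S 2 2)⁻¹ * S 0 2 = a at *
  generalize S 0 1 - S 0 2 * (S 2 2)⁻¹ * S 1 2 = b at *
  generalize S 1 1 - S 1 2 * (S 2 2)⁻¹ * S 1 2 = c at *
  rw [e00, e01, e11]
  generalize S 0 2 = p at *
  generalize S 1 2 = q at *
  generalize S 2 2 = s at *
  clear e00 e01 e11 hba hpi hdet hdb h01 h02 h12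
  clear_value D
  field_simp
  subst hD
  ring

end Conditioning

/-! ### Marginal densities, conditional density and conditional law. -/

section Marginals

variable {μ : EuclideanSpace ℝ (Fin 3)} {S : Matrix (Fin 3) (Fin 3) ℝ}

/-- The last factor is the law of `X₃` given the pair, with mean `μ₃ + Σ₃. Σ₁⁻¹ (x - m)` and
variance `|Σ| / |Σ₁|`. It integrates to one in `t`, which yields the marginal of the pair. -/
lemma gaussianDensity_eq_mul_cond (hS : S.PosDef) (x : EuclideanSpace ℝ (Fin 2)) (t : ℝ) :
    gaussianDensity μ S !₂[x 0, x 1, t] = gaussianDensity (firstTwo μ) (covPair S) x *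
      gaussianPDFReal (μ 2 + ((S 0 2 * S 1 1 - S 1 2 * S 0 1) * (x 0 - μ 0) +
        (S 1 2 * S 0 0 - S 0 2 * S 0 1) * (x 1 - μ 1)) / (covPair S).det)
        (S.det / (covPair S).det).toNNReal t := by
  have hd := hS.det_pos
  have hd1 := (posDef_covPair hS).det_pos
  unfold gaussianDensity gaussianPDFReal
  rw [mul_mul_mul_comm, ← Real.exp_add, ← mul_inv, ← Real.sqrt_mul (by positivity),
    Real.coe_toNNReal _ (by positivity)]
  have hpi : (2 * Real.pi) ^ 3 * S.det =
      (2 * Real.pi) ^ 2 * (covPair S).det * (2 * Real.pi * (S.det / (covPair S).det)) := by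
    field_simp
  rw [hpi]
  congr 2
  rw [Matrix.inv_def, Matrix.inv_def]
  have hD1 : (covPair S).det = S 0 0 * S 1 1 - S 0 1 * S 1 0 := by rw [covPair, det_fin_two_of]
  have hD := det_fin_three S
  have h01 : S 1 0 = S 0 1 := symm_of_posDef hS 0 1
  have h02 : S 2 0 = S 0 2 := symm_of_posDef hS 0 2
  have h12 : S 2 1 = S 1 2 := symm_of_posDef hS 1 2
  rw [h01] at hD1
  rw [h01, h02, h12] at hD
  -- The determinant is affine in `S 2 2`, so `S 2 2` can be eliminated in favour of `S.det`.
  have hs22 : S 2 2 * (covPair S).det = S.det + S 0 0 * S 1 2 ^ 2 + S 1 1 * S 0 2 ^ 2 -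
    2 * S 0 1 * S 0 2 * S 1 2 := by rw [hD, hD1]; ring
  have hs22' := (eq_div_iff hd1.ne').2 hs22
  simp only [adjugate_fin_three, adjugate_fin_two, covPair, firstTwo, Fin.sum_univ_three,
    Fin.sum_univ_two, Matrix.smul_apply, smul_eq_mul, Ring.inverse_eq_inv', of_apply, cons_val_zero,
    cons_val_one, cons_val, h01, h02, h12]
  simp only [covPair, h01] at hs22' hd1 hD1 ⊢
  rw [hs22']
  generalize det !![S 0 0, S 0 1; S 0 1, S 1 1] = D1 at *
  generalize S.det = D at *
  have hD10 := hd1.ne'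
  have hD0 := hd.ne'
  clear hs22 hs22' hpi hD h01 h02 h12
  field_simp
  subst hD1
  ring

lemma marginalThird_gaussianDensity (hS : S.PosDef) (t : ℝ) :
    marginalThird (gaussianDensity μ S) t = gaussianPDFReal (μ 2) (S 2 2).toNNReal t := by
  simp only [marginalThird, gaussianDensity_eq_cond_mul hS]
  rw [integral_mul_const, integral_gaussianDensity (posDef_sigmaBar hS), one_mul]

lemma condDensity_gaussianDensity (hS : S.PosDef) (t : ℝ) :
    condDensity (gaussianDensity μ S) t = gaussianDensity (muBar μ S t) (sigmaBar S) := by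
  funext x
  have h2 := hS.diag_pos (i := 2)
  rw [condDensity, marginalThird_gaussianDensity hS, gaussianDensity_eq_cond_mul hS,
    mul_div_cancel_right₀ _ (gaussianPDFReal_pos _ _ _ (by simpa using h2)).ne']

lemma marginalPair_gaussianDensity (hS : S.PosDef) :
    marginalPair (gaussianDensity μ S) = gaussianDensity (firstTwo μ) (covPair S) := by
  funext x
  simp only [marginalPair, gaussianDensity_eq_mul_cond hS]
  have hd := div_pos hS.det_pos (posDef_covPair hS).det_pos
  rw [integral_const_mul, integral_gaussianPDFReal_eq_one _ (by simpa using hd), mul_one]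

lemma measurePreserving_third_firstTwo :
    MeasurePreserving (fun x : EuclideanSpace ℝ (Fin 3) => (third x, firstTwo x)) volume
      (volume.prod volume) := by
  have h1 := PiLp.volume_preserving_ofLp (Fin 3)
  have h2 := volume_preserving_piFinSuccAbove (fun _ : Fin 3 => ℝ) 2
  have h3 := (MeasurePreserving.id (volume : Measure ℝ)).prod (PiLp.volume_preserving_toLp (Fin 2))
  convert! h3.comp (h2.comp h1) using 1
  funext x
  refine Prod.ext rfl ?_
  ext i
  fin_cases i <;> rfl

/-- The conditional law of the first two components given the third, as a kernel. -/
noncomputable def condKernelPair (μ : EuclideanSpace ℝ (Fin 3)) (S : Matrix (Fin 3) (Fin 3) ℝ) :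
    Kernel ℝ (EuclideanSpace ℝ (Fin 2)) :=
  (Kernel.id ×ₖ Kernel.const ℝ (stdGaussian (EuclideanSpace ℝ (Fin 2)))).map fun p =>
    muBar μ S p.1 + toEuclideanCLM (𝕜 := ℝ) (CFC.sqrt (sigmaBar S)) p.2

lemma continuous_muBar : Continuous (muBar μ S) := by
  refine (PiLp.continuous_toLp 2 _).comp (continuous_pi fun i => ?_)
  fin_cases i <;> simp <;> fun_prop

/-- Representing all conditional laws as images of one fixed standard Gaussian reduces measurability
in `t` to joint continuity. -/
lemma measurable_condKernelPair_map : Measurable fun p : ℝ × EuclideanSpace ℝ (Fin 2) =>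
    muBar μ S p.1 + toEuclideanCLM (𝕜 := ℝ) (CFC.sqrt (sigmaBar S)) p.2 := by
  have := continuous_muBar (μ := μ) (S := S)
  exact ((this.comp continuous_fst).add
    ((toEuclideanCLM (𝕜 := ℝ) (CFC.sqrt (sigmaBar S))).continuous.comp continuous_snd)).measurable

instance : IsMarkovKernel (condKernelPair μ S) :=
  Kernel.IsMarkovKernel.map _ measurable_condKernelPair_map

lemma condKernelPair_apply (t : ℝ) :
    condKernelPair μ S t = multivariateGaussian (muBar μ S t) (sigmaBar S) := by
  rw [condKernelPair, Kernel.map_apply _ measurable_condKernelPair_map, Kernel.prod_apply,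
    Kernel.id_apply, Kernel.const_apply, Measure.dirac_prod,
    Measure.map_map measurable_condKernelPair_map (by fun_prop)]
  rfl

lemma map_third_multivariateGaussian (hS : S.PosDef) :
    (multivariateGaussian μ S).map third =
      volume.withDensity (gaussianPDF (μ 2) (S 2 2).toNNReal) := by
  have h2 := hS.diag_pos (i := 2)
  rw [← gaussianReal_of_var_ne_zero _ (by simpa using h2)]
  exact (measurePreserving_eval_multivariateGaussian hS.posSemidef).map_eq

lemma measurable_third : Measurable third := by
  unfold third; fun_prop

lemma measurable_firstTwo : Measurable firstTwo := by
  refine ((PiLp.continuous_toLp 2 _).comp (continuous_pi fun i => ?_)).measurable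
  fin_cases i <;> simp <;> fun_prop

lemma toLp_firstTwo_third (x : EuclideanSpace ℝ (Fin 3)) :
    !₂[firstTwo x 0, firstTwo x 1, third x] = x := by
  ext i; fin_cases i <;> rfl

/-- By Tonelli, both measures integrate the same density, thanks to `gaussianDensity_eq_cond_mul`.
-/
lemma map_third_firstTwo_multivariateGaussian (hS : S.PosDef) :
    (multivariateGaussian μ S).map (fun x => (third x, firstTwo x)) =
      (multivariateGaussian μ S).map third ⊗ₘ condKernelPair μ S := by
  have hm : Measurable fun p : ℝ × EuclideanSpace ℝ (Fin 2) =>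
      ENNReal.ofReal (gaussianDensity μ S !₂[p.2 0, p.2 1, p.1]) := by
    refine (continuous_gaussianDensity.comp ((PiLp.continuous_toLp 2 _).comp
      (continuous_pi fun i => ?_))).measurable.ennreal_ofReal
    fin_cases i <;> simp <;> fun_prop
  rw [map_third_multivariateGaussian hS, multivariateGaussian_eq_withDensity hS,
    map_withDensity_of_map_eq_smul (ρ := volume.prod volume) (c := 1)
      (measurable_third.prodMk measurable_firstTwo)
      (by rw [measurePreserving_third_firstTwo.map_eq, one_smul]) hm
      (fun x => by rw [one_mul, toLp_firstTwo_third]) one_ne_zero ENNReal.one_ne_top]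
  ext s hs
  rw [withDensity_apply _ hs, ← lintegral_indicator hs, lintegral_prod _ (hm.indicator hs).aemeasurable,
    Measure.compProd_apply hs, lintegral_withDensity_eq_lintegral_mul _
      (measurable_gaussianPDF _ _) (Kernel.measurable_kernel_prodMk_left hs)]
  refine lintegral_congr fun t => ?_
  have hst : MeasurableSet (Prod.mk t ⁻¹' s) := measurable_prodMk_left hs
  rw [Pi.mul_apply, condKernelPair_apply, multivariateGaussian_eq_withDensity (posDef_sigmaBar hS),
    withDensity_apply _ hst, ← lintegral_indicator hst,
    ← lintegral_const_mul _ (continuous_gaussianDensity.measurable.ennreal_ofReal.indicator hst)]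
  refine lintegral_congr fun x => ?_
  by_cases hx : (t, x) ∈ s
  · rw [Set.indicator_of_mem hx, Set.indicator_of_mem (show x ∈ Prod.mk t ⁻¹' s from hx),
      gaussianDensity_eq_cond_mul hS, gaussianPDF, mul_comm,
      ENNReal.ofReal_mul (gaussianPDFReal_nonneg _ _ _)]
  · rw [Set.indicator_of_notMem hx, Set.indicator_of_notMem (show x ∉ Prod.mk t ⁻¹' s from hx),
      mul_zero]

lemma condDistrib_firstTwo_third {Ω : Type*} [MeasurableSpace Ω] {P : Measure Ω}
    [IsProbabilityMeasure P] {X : Ω → EuclideanSpace ℝ (Fin 3)} (hS : S.PosDef)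
    (hX : HasLaw X (multivariateGaussian μ S) P) :
    ∀ᵐ t ∂(P.map fun ω => third (X ω)),
      condDistrib (fun ω => firstTwo (X ω)) (fun ω => third (X ω)) P t =
        multivariateGaussian (muBar μ S t) (sigmaBar S) := by
  have hXm := hX.aemeasurable
  have key : condDistrib (fun ω => firstTwo (X ω)) (fun ω => third (X ω)) P
      =ᵐ[P.map fun ω => third (X ω)] condKernelPair μ S := by
    refine condDistrib_ae_eq_of_measure_eq_compProd _
      (measurable_firstTwo.comp_aemeasurable hXm) ?_
    have h1 := AEMeasurable.map_map_of_aemeasurable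
      (g := fun x => (third x, firstTwo x))
      (measurable_third.prodMk measurable_firstTwo).aemeasurable hXm
    have h2 := AEMeasurable.map_map_of_aemeasurable measurable_third.aemeasurable hXm
    rw [hX.map_eq] at h1 h2
    rw [map_third_firstTwo_multivariateGaussian hS, h2] at h1
    exact h1.symm
  filter_upwards [key] with t ht
  rw [ht, condKernelPair_apply]

end Marginals

/-! ### Entropy integrals with polynomial weights. -/

section PolynomialWeights

open MvPolynomial

variable {n : ℕ} {m m' : EuclideanSpace ℝ (Fin n)} {C C' : Matrix (Fin n) (Fin n) ℝ}

lemma integrable_eval_mul_gaussianDensity (hC : C.PosDef) (p : MvPolynomial (Fin n) ℝ) :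
    Integrable fun x => eval (fun i => x i - m i) p * gaussianDensity m C x :=
  (integrable_multivariateGaussian_iff hC _).1 (integrable_eval_multivariateGaussian p)

lemma integral_eval_mul_gaussianDensity (hC : C.PosDef) (p : MvPolynomial (Fin n) ℝ) :
    ∫ x, eval (fun i => x i - m i) p * gaussianDensity m C x = gaussMoment C p := by
  rw [← integral_multivariateGaussian hC, integral_eval_multivariateGaussian]

/-- The logarithm of the density of `N(m', C')` as a polynomial in `x - m`, with `e = m - m'`. -/
noncomputable def logPoly (C' : Matrix (Fin n) (Fin n) ℝ) (e : Fin n → ℝ) :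
    MvPolynomial (Fin n) ℝ :=
  MvPolynomial.C (-(1 / 2) * Real.log ((2 * Real.pi) ^ n * C'.det)) -
    MvPolynomial.C (1 / 2) * ∑ i, ∑ j, MvPolynomial.C (C'⁻¹ i j) *
      ((X i + MvPolynomial.C (e i)) * (X j + MvPolynomial.C (e j)))

lemma eval_logPoly (hC' : C'.PosDef) {e : Fin n → ℝ} (he : ∀ i, e i = m i - m' i)
    (x : EuclideanSpace ℝ (Fin n)) :
    eval (fun i => x i - m i) (logPoly C' e) = Real.log (gaussianDensity m' C' x) := by
  rw [log_gaussianDensity hC', logPoly]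
  simp only [map_sub, map_mul, map_sum, map_add, eval_C, eval_X, he, sub_add_sub_cancel]

lemma gaussMoment_mul_logPoly (p : MvPolynomial (Fin n) ℝ) (e : Fin n → ℝ) :
    gaussMoment C (p * logPoly C' e) =
      -(1 / 2 * Real.log ((2 * Real.pi) ^ n * C'.det) * gaussMoment C p + 1 / 2 * ∑ i, ∑ j,
        C'⁻¹ i j * gaussMoment C
          (p * (X i + MvPolynomial.C (e i)) * (X j + MvPolynomial.C (e j)))) := by
  simp only [logPoly, mul_sub, ← MvPolynomial.smul_eq_C_mul, mul_smul_comm, Finset.mul_sum,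
    map_sub, map_smul, map_sum, smul_eq_mul, gaussMoment_C_mul, mul_assoc]
  ring_nf

lemma integrable_eval_mul_gaussianDensity_mul_log (hC : C.PosDef) (hC' : C'.PosDef)
    {e : Fin n → ℝ} (he : ∀ i, e i = m i - m' i) (p : MvPolynomial (Fin n) ℝ) :
    Integrable fun x => eval (fun i => x i - m i) p * gaussianDensity m C x *
      Real.log (gaussianDensity m' C' x) := by
  refine (integrable_eval_mul_gaussianDensity (m := m) hC (p * logPoly C' e)).congr
    (Filter.Eventually.of_forall fun x => ?_)
  simp only [map_mul, eval_logPoly hC' he]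
  ring

lemma integral_eval_mul_gaussianDensity_mul_log (hC : C.PosDef) (hC' : C'.PosDef)
    {e : Fin n → ℝ} (he : ∀ i, e i = m i - m' i) (p : MvPolynomial (Fin n) ℝ) :
    -∫ x, eval (fun i => x i - m i) p * gaussianDensity m C x *
      Real.log (gaussianDensity m' C' x) =
      1 / 2 * Real.log ((2 * Real.pi) ^ n * C'.det) * gaussMoment C p + 1 / 2 * ∑ i, ∑ j,
        C'⁻¹ i j * gaussMoment C
          (p * (X i + MvPolynomial.C (e i)) * (X j + MvPolynomial.C (e j))) := by
  rw [neg_eq_iff_eq_neg, ← gaussMoment_mul_logPoly,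
    ← integral_eval_mul_gaussianDensity (m := m) hC]
  congr 1
  funext x
  simp only [map_mul, eval_logPoly hC' he]
  ring

/-- The sum is the trace of `C⁻¹ * C`, as `C` is symmetric. -/
lemma sum_inv_mul_self (hC : C.PosDef) : ∑ i, ∑ j, C⁻¹ i j * C i j = n := by
  have h : (C⁻¹ * C).trace = n := by
    rw [nonsing_inv_mul _ hC.det_pos.ne'.isUnit, trace_one, Fintype.card_fin]
  rw [← h]
  refine Finset.sum_congr rfl fun i _ => ?_
  rw [diag_apply, mul_apply]
  refine Finset.sum_congr rfl fun j _ => ?_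
  rw [show C i j = C j i by simpa using hC.isHermitian.apply j i]

lemma gaussMoment_add_C_mul_add_C (hC : C.PosDef) (e : Fin n → ℝ) (i j : Fin n) :
    gaussMoment C ((X i + MvPolynomial.C (e i)) * (X j + MvPolynomial.C (e j))) =
      C i j + e i * e j := by
  rw [mul_add, add_mul, map_add, map_add, gaussMoment_C_mul, mul_comm (MvPolynomial.C _),
    gaussMoment_C_mul, map_add, gaussMoment_C, gaussMoment_X2 hC.posSemidef,
    gaussMoment_X hC.posSemidef, gaussMoment_X hC.posSemidef]
  ring

lemma eval_weightPoly (m mb : EuclideanSpace ℝ (Fin 2)) {d : Fin 2 → ℝ}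
    (hd : ∀ i, d i = mb i - m i) (x : EuclideanSpace ℝ (Fin 2)) :
    eval (fun i => x i - mb i) (weightPoly (d 0) (d 1)) = ∏ k, (x k - m k) ^ 2 := by
  simp [weightPoly, hd, Fin.prod_univ_two]

end PolynomialWeights

end WeightedGaussian

/-! ### Assembly of the entropy and divergence formulas. -/

open WeightedGaussian

theorem mainTheorem6 {Ω : Type*} [MeasurableSpace Ω] (P : Measure Ω) [IsProbabilityMeasure P]
    (X : Ω → EuclideanSpace ℝ (Fin 3)) (μ : EuclideanSpace ℝ (Fin 3))
    (S : Matrix (Fin 3) (Fin 3) ℝ) (hS : S.PosDef)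
    (hX : HasLaw X (multivariateGaussian μ S) P)
    (f : EuclideanSpace ℝ (Fin 3) → ℝ) (hf : f = WeightedGaussian.gaussianDensity μ S)
    (f₁₂ : EuclideanSpace ℝ (Fin 2) → ℝ) (hf₁₂ : f₁₂ = WeightedGaussian.marginalPair f)
    (m : EuclideanSpace ℝ (Fin 2)) (hm : m = WeightedGaussian.firstTwo μ)
    (S₁ : Matrix (Fin 2) (Fin 2) ℝ) (hS₁ : S₁ = WeightedGaussian.covPair S)
    (Sb : Matrix (Fin 2) (Fin 2) ℝ) (hSb : Sb = WeightedGaussian.sigmaBar S) :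
    -- `f` is the joint density of `X`, and `f₁₂` is the `N(m, S₁)` density
    P.map X = volume.withDensity (fun x => ENNReal.ofReal (f x)) ∧
    S₁.PosDef ∧ Sb.PosDef ∧
    f₁₂ = WeightedGaussian.gaussianDensity m S₁ ∧
    -- the conditional law of `(X₁, X₂)` given `X₃` is `N(mb, Sb)`
    (∀ᵐ x₃ ∂(P.map fun ω => WeightedGaussian.third (X ω)),
      condDistrib (fun ω => WeightedGaussian.firstTwo (X ω))
          (fun ω => WeightedGaussian.third (X ω)) P x₃ =
        multivariateGaussian (WeightedGaussian.muBar μ S x₃) Sb) ∧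
    ∀ (x₃ : ℝ) (mb : EuclideanSpace ℝ (Fin 2)) (fc φ φr φ' : EuclideanSpace ℝ (Fin 2) → ℝ)
      (Θ : ℝ) (Λ Υ : Fin 2 → Fin 2 → ℝ) (d : Fin 2 → ℝ),
      mb = WeightedGaussian.muBar μ S x₃ →
      fc = WeightedGaussian.condDensity f x₃ →
      φ = WeightedGaussian.centralWeight m →
      φr = WeightedGaussian.ratioWeight f x₃ →
      φ' = WeightedGaussian.centralRatioWeight f m x₃ →
      Θ = WeightedGaussian.Theta f m x₃ →
      Λ = WeightedGaussian.LambdaBar f m mb x₃ →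
      Υ = WeightedGaussian.Upsilon f m x₃ →
      d = WeightedGaussian.meanShift μ S x₃ →
      fc = WeightedGaussian.gaussianDensity mb Sb ∧
      -- all the integrals involved converge absolutely
      (Integrable (fun x => fc x * Real.log (fc x)) ∧
        Integrable (fun x => φr x * f₁₂ x * Real.log (f₁₂ x)) ∧
        Integrable (fun x => fc x * Real.log (fc x / f₁₂ x)) ∧
        Integrable (fun x => φ x * fc x * Real.log (fc x)) ∧
        Integrable (fun x => φ' x * f₁₂ x * Real.log (f₁₂ x)) ∧
        Integrable (fun x => φ x * fc x * Real.log (fc x / f₁₂ x)) ∧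
        Integrable (fun x => (∏ k, (x k - m k) ^ 2) * fc x) ∧
        (∀ i j, Integrable
          (fun x => (∏ k, (x k - m k) ^ 2) * (x i - mb i) * (x j - mb j) * fc x)) ∧
        (∀ i j, Integrable
          (fun x => (∏ k, (x k - m k) ^ 2) * (x i - m i) * (x j - m j) * fc x))) ∧
      -- the Kullback-Leibler divergence
      (WeightedGaussian.relEntropy fc f₁₂ =
          WeightedGaussian.weightedEntropy φr f₁₂ - WeightedGaussian.diffEntropy fc ∧
        WeightedGaussian.diffEntropy fc =
          1 / 2 * Real.log ((2 * Real.pi * Real.exp 1) ^ 2 * Sb.det) ∧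
        WeightedGaussian.weightedEntropy φr f₁₂ =
          1 / 2 * Real.log ((2 * Real.pi) ^ 2 * S₁.det) +
          1 / 2 * ∑ i, ∑ j, S₁⁻¹ i j *
            (Sb i j + mb i * mb j - m j * mb i - m i * mb j + m i * m j) ∧
        WeightedGaussian.relEntropy fc f₁₂ =
          1 / 2 * Real.log ((2 * Real.pi) ^ 2 * S₁.det) -
          1 / 2 * Real.log ((2 * Real.pi) ^ 2 * Sb.det) +
          1 / 2 * ∑ i, ∑ j, S₁⁻¹ i j *
            (Sb i j + mb i * mb j - m j * mb i - m i * mb j + m i * m j) - 1) ∧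
      -- the conditional weighted entropy
      WeightedGaussian.weightedEntropy φ fc =
        1 / 2 * Real.log ((2 * Real.pi) ^ 2 * Sb.det) * Θ +
        1 / 2 * ∑ i, ∑ j, Sb⁻¹ i j * Λ i j ∧
      -- the weighted entropy with weight `φ'`
      WeightedGaussian.weightedEntropy φ' f₁₂ =
        1 / 2 * Real.log ((2 * Real.pi) ^ 2 * S₁.det) * Θ +
        1 / 2 * ∑ i, ∑ j, S₁⁻¹ i j * Υ i j ∧
      -- the weighted Kullback-Leibler divergence
      (WeightedGaussian.relWeightedEntropy φ fc f₁₂ =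
          WeightedGaussian.weightedEntropy φ' f₁₂ - WeightedGaussian.weightedEntropy φ fc ∧
        WeightedGaussian.relWeightedEntropy φ fc f₁₂ =
          1 / 2 * Real.log (S₁.det / Sb.det) * Θ +
          1 / 2 * ∑ i, ∑ j, S₁⁻¹ i j * Υ i j -
          1 / 2 * ∑ i, ∑ j, Sb⁻¹ i j * Λ i j) ∧
      -- the explicit values of the conditional moments
      Θ = WeightedGaussian.thetaExpr Sb d ∧
      (∀ i j, Λ i j = WeightedGaussian.lambdaExpr Sb d i j) ∧
      (∀ i j, Υ i j = WeightedGaussian.upsilonExpr Sb d i j) := by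
  subst hf hf₁₂ hm hS₁ hSb
  have hS1 := posDef_covPair hS
  have hSb := posDef_sigmaBar hS
  refine ⟨by rw [hX.map_eq, multivariateGaussian_eq_withDensity hS], hS1, hSb,
    marginalPair_gaussianDensity hS, condDistrib_firstTwo_third hS hX, ?_⟩
  intro x₃ mb fc φ φr φ' Θ Λ Υ d hmb hfc hφ hφr hφ' hΘ hΛ hΥ hd
  have hf12 := marginalPair_gaussianDensity (μ := μ) hS
  have hfc' : fc = gaussianDensity mb (sigmaBar S) := by
    rw [hfc, condDensity_gaussianDensity hS, hmb]
  rw [hf12]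
  set m := firstTwo μ with hm
  set Sb := sigmaBar S
  set S₁ := covPair S
  have hde (i : Fin 2) : d i = mb i - m i := by
    rw [hd, hmb, hm]
    fin_cases i <;> simp [meanShift, muBar, firstTwo]
  -- The shift is zero for the logarithm of `fc`, which is centred at `mb`, and `d` for that of
  -- `f₁₂`.
  have h0e (i : Fin 2) : (0 : Fin 2 → ℝ) i = mb i - mb i := by simp
  set f₁₂ := gaussianDensity m S₁
  have hpos1 (x) : f₁₂ x ≠ 0 := (gaussianDensity_pos hS1 x).ne'
  have hposc (x) : fc x ≠ 0 := by rw [hfc']; exact (gaussianDensity_pos hSb x).ne'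
  have hφ_eval : φ = fun x => MvPolynomial.eval (fun i => x i - mb i) (weightPoly (d 0) (d 1)) := by
    funext x; rw [hφ, eval_weightPoly m mb hde]; rfl
  have hφr_mul (x) : φr x * f₁₂ x = fc x := by
    rw [hφr, ratioWeight, hf12, ← hfc, div_mul_cancel₀ _ (hpos1 x)]
  have hφ'_mul (x) : φ' x * f₁₂ x = φ x * fc x := by
    rw [hφ', centralRatioWeight, ← hφr, mul_assoc, hφr_mul, hφ]
  have hlog (x) : Real.log (fc x / f₁₂ x) = Real.log (fc x) - Real.log (f₁₂ x) :=
    Real.log_div (hposc x) (hpos1 x)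
  have hi1 : Integrable fun x => fc x * Real.log (fc x) := by
    simpa [← hfc'] using integrable_eval_mul_gaussianDensity_mul_log (m := mb) hSb hSb h0e 1
  have hi2 : Integrable fun x => fc x * Real.log (f₁₂ x) := by
    simpa [← hfc'] using integrable_eval_mul_gaussianDensity_mul_log (m := mb) hSb hS1 hde 1
  have hi3 : Integrable fun x => φ x * fc x * Real.log (fc x) := by
    simpa [← hfc', hφ_eval] using integrable_eval_mul_gaussianDensity_mul_log (m := mb) hSb hSb h0e
      (weightPoly (d 0) (d 1))
  have hi4 : Integrable fun x => φ x * fc x * Real.log (f₁₂ x) := by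
    simpa [← hfc', hφ_eval] using integrable_eval_mul_gaussianDensity_mul_log (m := mb) hSb hS1 hde
      (weightPoly (d 0) (d 1))
  -- The summand `1` is half the trace of the `2 × 2` identity; it later becomes the factor `e²`
  -- inside the logarithm.
  have hI1 : diffEntropy fc = 1 / 2 * Real.log ((2 * Real.pi) ^ 2 * Sb.det) + 1 := by
    have h := integral_eval_mul_gaussianDensity_mul_log (m := mb) hSb hSb h0e 1
    simp only [gaussMoment_add_C_mul_add_C hSb (0 : Fin 2 → ℝ), map_one, one_mul,
      gaussMoment_one, ← hfc'] at h
    simp only [Pi.zero_apply, mul_zero, add_zero, sum_inv_mul_self hSb] at h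
    rw [diffEntropy, h]
    norm_num
  have hI2 : weightedEntropy φr f₁₂ = 1 / 2 * Real.log ((2 * Real.pi) ^ 2 * S₁.det) +
      1 / 2 * ∑ i, ∑ j, S₁⁻¹ i j *
        (Sb i j + mb i * mb j - m j * mb i - m i * mb j + m i * m j) := by
    have h := integral_eval_mul_gaussianDensity_mul_log (m := mb) hSb hS1 hde 1
    simp only [gaussMoment_add_C_mul_add_C hSb, map_one, one_mul, gaussMoment_one, ← hfc',
      mul_one] at h
    simp only [weightedEntropy, hφr_mul]
    rw [h]
    congr 2
    refine Finset.sum_congr rfl fun i _ => Finset.sum_congr rfl fun j _ => ?_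
    rw [hde, hde]
    ring
  have hΘ' : Θ = gaussMoment Sb (weightPoly (d 0) (d 1)) := by
    rw [← integral_eval_mul_gaussianDensity (m := mb) hSb, hΘ, Theta, condMean, ← hfc, hfc']
    simp only [eval_weightPoly m mb hde]
  have hΛ_eval (x : EuclideanSpace ℝ (Fin 2)) (i j : Fin 2) :
      (∏ k, (x k - m k) ^ 2) * (x i - mb i) * (x j - mb j) =
        MvPolynomial.eval (fun i => x i - mb i) (weightPoly (d 0) (d 1) *
          (MvPolynomial.X i + MvPolynomial.C ((0 : Fin 2 → ℝ) i)) *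
          (MvPolynomial.X j + MvPolynomial.C ((0 : Fin 2 → ℝ) j))) := by
    simp [eval_weightPoly m mb hde]
  have hΥ_eval (x : EuclideanSpace ℝ (Fin 2)) (i j : Fin 2) :
      (∏ k, (x k - m k) ^ 2) * (x i - m i) * (x j - m j) =
        MvPolynomial.eval (fun i => x i - mb i) (weightPoly (d 0) (d 1) *
          (MvPolynomial.X i + MvPolynomial.C (d i)) *
          (MvPolynomial.X j + MvPolynomial.C (d j))) := by
    rw [← eval_weightPoly m mb hde]
    simp only [map_mul, map_add, MvPolynomial.eval_X, MvPolynomial.eval_C, hde,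
      sub_add_sub_cancel]
  have hΛ' (i j) : Λ i j = gaussMoment Sb (weightPoly (d 0) (d 1) *
      (MvPolynomial.X i + MvPolynomial.C ((0 : Fin 2 → ℝ) i)) *
      (MvPolynomial.X j + MvPolynomial.C ((0 : Fin 2 → ℝ) j))) := by
    rw [← integral_eval_mul_gaussianDensity (m := mb) hSb, hΛ, LambdaBar, condMean, ← hfc, hfc']
    simp only [hΛ_eval]
  have hΥ' (i j) : Υ i j = gaussMoment Sb (weightPoly (d 0) (d 1) *
      (MvPolynomial.X i + MvPolynomial.C (d i)) * (MvPolynomial.X j + MvPolynomial.C (d j))) := by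
    rw [← integral_eval_mul_gaussianDensity (m := mb) hSb, hΥ, Upsilon, condMean, ← hfc, hfc']
    simp only [hΥ_eval]
  have hI3 : weightedEntropy φ fc = 1 / 2 * Real.log ((2 * Real.pi) ^ 2 * Sb.det) * Θ +
      1 / 2 * ∑ i, ∑ j, Sb⁻¹ i j * Λ i j := by
    have h := integral_eval_mul_gaussianDensity_mul_log (m := mb) hSb hSb h0e
      (weightPoly (d 0) (d 1))
    simp only [← hΛ', ← hΘ', ← hfc'] at h
    rw [← h, weightedEntropy, hφ_eval]
  have hI4 : weightedEntropy φ' f₁₂ = 1 / 2 * Real.log ((2 * Real.pi) ^ 2 * S₁.det) * Θ +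
      1 / 2 * ∑ i, ∑ j, S₁⁻¹ i j * Υ i j := by
    have h := integral_eval_mul_gaussianDensity_mul_log (m := mb) hSb hS1 hde
      (weightPoly (d 0) (d 1))
    simp only [← hΥ', ← hΘ', ← hfc'] at h
    simp only [weightedEntropy, hφ'_mul]
    rw [← h, hφ_eval]
  have hD1 : relEntropy fc f₁₂ = weightedEntropy φr f₁₂ - diffEntropy fc := by
    simp only [relEntropy, weightedEntropy, diffEntropy, hφr_mul, hlog, mul_sub]
    rw [integral_sub hi1 hi2]
    ring
  have hD2 : relWeightedEntropy φ fc f₁₂ = weightedEntropy φ' f₁₂ - weightedEntropy φ fc := by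
    simp only [relWeightedEntropy, weightedEntropy, hφ'_mul, hlog, mul_sub]
    rw [integral_sub hi3 hi4]
    ring
  have hdS := hS1.det_pos
  have hdb := hSb.det_pos
  have hpi := Real.pi_pos
  refine ⟨hfc', ⟨hi1, by simpa only [hφr_mul] using hi2, ?_, hi3,
    by simpa only [hφ'_mul] using hi4, ?_, ?_, fun i j => ?_, fun i j => ?_⟩,
    ⟨hD1, ?_, hI2, ?_⟩, hI3, hI4, ⟨hD2, ?_⟩, ?_, fun i j => ?_, fun i j => ?_⟩
  · exact (hi1.sub hi2).congr (Filter.Eventually.of_forall fun x => by simp [hlog, mul_sub])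
  · exact (hi3.sub hi4).congr (Filter.Eventually.of_forall fun x => by simp [hlog, mul_sub])
  · have := integrable_eval_mul_gaussianDensity (m := mb) hSb (weightPoly (d 0) (d 1))
    simpa only [eval_weightPoly m mb hde, ← hfc'] using this
  · simp only [hΛ_eval, hfc']
    exact integrable_eval_mul_gaussianDensity hSb _
  · simp only [hΥ_eval, hfc']
    exact integrable_eval_mul_gaussianDensity hSb _
  · have : (2 * Real.pi * Real.exp 1) ^ 2 * Sb.det =
        (2 * Real.pi) ^ 2 * Sb.det * Real.exp 1 ^ 2 := by ring
    have hexp : Real.log ((2 * Real.pi) ^ 2 * Sb.det * Real.exp 1 ^ 2) =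
        Real.log ((2 * Real.pi) ^ 2 * Sb.det) + 2 := by
      rw [Real.log_mul (by positivity) (by positivity), Real.log_pow, Real.log_exp]
      norm_num
    rw [hI1, this, hexp]
    ring
  · rw [hD1, hI1, hI2]
    ring
  · rw [hD2, hI3, hI4, Real.log_mul (by positivity) hdS.ne', Real.log_mul (by positivity) hdb.ne',
      Real.log_div hdS.ne' hdb.ne']
    ring
  · rw [hΘ', gaussMoment_weightPoly hSb.posSemidef]
    simp [thetaExpr]
  · rw [hΛ', gaussMoment_weightPoly_mul_mul hSb.posSemidef]
    simp only [lambdaExpr, Pi.zero_apply]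
    ring
  · rw [hΥ', gaussMoment_weightPoly_mul_mul hSb.posSemidef, upsilonExpr]
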